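/- Let $\mathcal M$ and $\bar{\mathcal M}$ be finite-dimensional smooth Riemannian manifolds without boundary (for instance connected and complete ones), and let $\varphi:\bar{\mathcal M}\to\mathcal M$ be an isometry, that is, a smooth diffeomorphism with $\langle \mathrm d\varphi_p u,\mathrm d\varphi_p v\rangle=\langle u,v\rangle$ for all $p\in\bar{\mathcal M}$ and $u,v\in T_p\bar{\mathcal M}$. For points $p,q$ of a Riemannian manifold $\mathcal N$ let $\Gamma_{pq}$ be the set of all geodesic segments $\gamma:[0,1]\to\mathcal N$ with $\gamma(0)=p$ and $\gamma(1)=q$, i.e. of all restrictions to $[0,1]$ of smooth curves, defined on an open interval containing $[0,1]$, that satisfy $\nabla_{\gamma'}\gamma'=0$ for the Levi-Civita connection $\nabla$ of $\mathcal N$. A function $h:\mathcal N\to\mathbb R$ is called convex on $\mathcal N$ if $h(\gamma(t))\le(1-t)\,h(p)+t\,h(q)$ for all $p,q\in\mathcal N$, all $\gamma\in\Gamma_{pq}$ and all $t\in[0,1]$. Then a function $g:\mathcal M\to\mathbb R$ is convex on $\mathcal M$ if and only if the function $g\circ\varphi:\bar{\mathcal M}\to\mathbb R$ is convex on $\bar{\mathcal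 M}$. -/

import Mathlib

open Bundle
open scoped Manifold ContDiff

noncomputable section RiemannianGeodesics

variable {E : Type*} [NormedAddCommGroup E] [NormedSpace ℝ E]
  {H : Type*} [TopologicalSpace H] (I : ModelWithCorners ℝ E H)
  {M : Type*} [TopologicalSpace M] [ChartedSpace H M]
  [RiemannianBundle (fun x : M ↦ TangentSpace I x)]

/-- The Riemannian metric in the coordinates of the chart centred at `x₀`: the value
`g_y(u, v)` at the coordinate point `y` on the coordinate vectors `u` and `v`. -/
def metricInChart (x₀ : M) (y u v : E) : ℝ :=
  inner ℝ (mfderiv 𝓘(ℝ, E) I (extChartAt I x₀).symm y u)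
    (mfderiv 𝓘(ℝ, E) I (extChartAt I x₀).symm y v)

/-- The Christoffel symbols of the first kind of the Levi-Civita connection, given by the Koszul
formula for the constant coordinate fields `u`, `v`, `w` (whose Lie brackets vanish):
`⟨∇_u v, w⟩ = (∂_u g(v, w) + ∂_v g(u, w) - ∂_w g(u, v)) / 2`. -/
def christoffelFirst (x₀ : M) (y u v w : E) : ℝ :=
  (fderiv ℝ (fun z ↦ metricInChart I x₀ z v w) y u
    + fderiv ℝ (fun z ↦ metricInChart I x₀ z u w) y v
    - fderiv ℝ (fun z ↦ metricInChart I x₀ z u v) y w) / 2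

/-- The Christoffel symbols (of the second kind) of the Levi-Civita connection: the coordinate
vector `∇_u v` for the constant coordinate fields `u`, `v`, that is, the unique vector whose metric
pairing with every `w` is `christoffelFirst I x₀ y u v w`. Existence and uniqueness at the points
of the chart are `metricInChart_christoffel` and `metricInChart_left_injective`. -/
def christoffel (x₀ : M) (y u v : E) : E :=
  Classical.epsilon fun a ↦ ∀ w, metricInChart I x₀ y a w = christoffelFirst I x₀ y u v w

/-- The covariant derivative `∇_{γ'} γ'` of the velocity of the curve `γ` along `γ` at time `t`,
written in the coordinates of the chart centred at `γ t`. -/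
def covariantAcceleration (γ : ℝ → M) (t : ℝ) : E :=
  let c : ℝ → E := fun s ↦ extChartAt I (γ t) (γ s)
  deriv (deriv c) t + christoffel I (γ t) (c t) (deriv c t) (deriv c t)

/-- `γ` is a geodesic on the open set `s` of times (in practice an open interval): it is smooth
there and satisfies the geodesic equation `∇_{γ'} γ' = 0` there. -/
def IsGeodesicOn (γ : ℝ → M) (s : Set ℝ) : Prop :=
  ContMDiffOn 𝓘(ℝ, ℝ) I ∞ γ s ∧ ∀ t ∈ s, covariantAcceleration I γ t = 0

/-- The set `Γ_{pq}` of all geodesic segments `γ : [0, 1] → M` from `p` to `q`, i.e. of all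
restrictions to `[0, 1]` of geodesics defined on an open interval containing `[0, 1]`. -/
def geodesicSegments (p q : M) : Set (Set.Icc (0 : ℝ) 1 → M) :=
  {γ | γ 0 = p ∧ γ 1 = q ∧ ∃ (c : ℝ → M) (a b : ℝ), a < 0 ∧ 1 < b ∧
    IsGeodesicOn I c (Set.Ioo a b) ∧ ∀ t : Set.Icc (0 : ℝ) 1, γ t = c t}

/-- `g : M → ℝ` is (geodesically) convex: `g ∘ γ` lies below its chord for all points `p`, `q` and
all geodesic segments `γ` from `p` to `q`, minimal or not. -/
def GeodesicallyConvex (g : M → ℝ) : Prop :=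
  ∀ p q : M, ∀ γ ∈ geodesicSegments I p q, ∀ t : Set.Icc (0 : ℝ) 1,
    g (γ t) ≤ (1 - (t : ℝ)) * g p + (t : ℝ) * g q

variable {I}
  {E' : Type*} [NormedAddCommGroup E'] [NormedSpace ℝ E']
  {H' : Type*} [TopologicalSpace H'] {I' : ModelWithCorners ℝ E' H'}
  {M' : Type*} [TopologicalSpace M'] [ChartedSpace H' M']
  [RiemannianBundle (fun x : M' ↦ TangentSpace I' x)]

/-- An isometry of Riemannian manifolds: a smooth diffeomorphism (with smooth inverse) whose
differential at every point preserves the Riemannian metrics. -/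
def IsRiemannianIsometry (φ : M' ≃ₘ⟮I', I⟯ M) : Prop :=
  ∀ (p : M') (u v : TangentSpace I' p),
    inner ℝ (mfderiv I' I φ p u) (mfderiv I' I φ p v) = inner ℝ u v

theorem metricInChart_add_left (x₀ : M) (y u u' v : E) :
    metricInChart I x₀ y (u + u') v = metricInChart I x₀ y u v + metricInChart I x₀ y u' v :=
  let D := mfderiv 𝓘(ℝ, E) I (extChartAt I x₀).symm y
  (congrArg (fun a ↦ inner ℝ a (D v)) (map_add D u u')).trans (inner_add_left (D u) (D u') (D v))

theorem metricInChart_smul_left (x₀ : M) (y : E) (r : ℝ) (u v : E) :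
    metricInChart I x₀ y (r • u) v = r • metricInChart I x₀ y u v :=
  let D := mfderiv 𝓘(ℝ, E) I (extChartAt I x₀).symm y
  (congrArg (fun a ↦ inner ℝ a (D v)) (map_smul D r u)).trans
    (real_inner_smul_left (D u) (D v) r)

theorem metricInChart_symm (x₀ : M) (y u v : E) :
    metricInChart I x₀ y u v = metricInChart I x₀ y v u :=
  let D := mfderiv 𝓘(ℝ, E) I (extChartAt I x₀).symm y
  real_inner_comm (D v) (D u)

theorem metricInChart_add_right (x₀ : M) (y u v v' : E) :
    metricInChart I x₀ y u (v + v') = metricInChart I x₀ y u v + metricInChart I x₀ y u v' := by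
  rw [metricInChart_symm, metricInChart_add_left, metricInChart_symm x₀ y v,
    metricInChart_symm x₀ y v']

theorem metricInChart_smul_right (x₀ : M) (y : E) (r : ℝ) (u v : E) :
    metricInChart I x₀ y u (r • v) = r • metricInChart I x₀ y u v := by
  rw [metricInChart_symm, metricInChart_smul_left, metricInChart_symm x₀ y v]

/-- In the points of a chart the metric is nondegenerate. -/
theorem metricInChart_left_injective [I.Boundaryless] [IsManifold I ∞ M] {x₀ : M} {y a : E}
    (hy : y ∈ (extChartAt I x₀).target) (h : ∀ w, metricInChart I x₀ y a w = 0) : a = 0 := by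
  have h0 := inner_self_eq_zero.1 (h a)
  have hinv := isInvertible_mfderivWithin_extChartAt_symm (I := I) hy
  rw [I.range_eq_univ, mfderivWithin_univ] at hinv
  exact hinv.injective (h0.trans (map_zero _).symm)

/-- In the points of a chart the metric coefficients are differentiable. -/
theorem differentiableAt_metricInChart [I.Boundaryless] [IsManifold I ∞ M]
    [IsContMDiffRiemannianBundle I ∞ E (fun x : M ↦ TangentSpace I x)] {x₀ : M} {y : E}
    (hy : y ∈ (extChartAt I x₀).target) (u v : E) :
    DifferentiableAt ℝ (fun z ↦ metricInChart I x₀ z u v) y := by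
  have hopen : IsOpen (extChartAt I x₀).target := isOpen_extChartAt_target x₀
  have hs : ContMDiffOn 𝓘(ℝ, E) I ∞ (extChartAt I x₀).symm (extChartAt I x₀).target :=
    contMDiffOn_extChartAt_symm x₀
  have ht := hs.contMDiffOn_tangentMapWithin (m := 1) (by norm_cast) hopen.uniqueMDiffOn
  have key : ∀ a : E, MDifferentiableAt 𝓘(ℝ, E) I.tangent
      (fun z ↦ (⟨(extChartAt I x₀).symm z, mfderiv 𝓘(ℝ, E) I (extChartAt I x₀).symm z a⟩ :
        TangentBundle I M)) y := by
    intro a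
    have hc : ContMDiff 𝓘(ℝ, E) 𝓘(ℝ, E).tangent 1
        (fun z : E ↦ (⟨z, a⟩ : TangentBundle 𝓘(ℝ, E) E)) := by
      intro z
      refine contMDiffAt_totalSpace.2 ⟨contMDiffAt_id, ?_⟩
      simpa using contMDiffAt_const
    have h1 := ht.comp (s := (extChartAt I x₀).target) hc.contMDiffOn (fun z hz ↦ hz)
    have h2 := (h1.contMDiffAt (hopen.mem_nhds hy)).mdifferentiableAt one_ne_zero
    refine h2.congr_of_eventuallyEq ?_
    filter_upwards [hopen.mem_nhds hy] with z hz
    simp only [Function.comp, tangentMapWithin]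
    rw [mfderivWithin_of_isOpen hopen hz]
  have h : MDifferentiableAt 𝓘(ℝ, E) 𝓘(ℝ, ℝ) (fun z ↦ metricInChart I x₀ z u v) y := by
    refine MDifferentiableAt.inner_bundle (IB := I) (F := E) (E := fun x : M ↦ TangentSpace I x)
      (b := (extChartAt I x₀).symm)
      (v := fun z ↦ mfderiv 𝓘(ℝ, E) I (extChartAt I x₀).symm z u)
      (w := fun z ↦ mfderiv 𝓘(ℝ, E) I (extChartAt I x₀).symm z v) ?_ ?_
    exacts [key u, key v]
  exact h.differentiableAt

/-- The defining property of the Christoffel symbols. -/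
theorem metricInChart_christoffel [FiniteDimensional ℝ E] [I.Boundaryless] [IsManifold I ∞ M]
    [IsContMDiffRiemannianBundle I ∞ E (fun x : M ↦ TangentSpace I x)]
    {x₀ : M} {y : E} (hy : y ∈ (extChartAt I x₀).target) (u v w : E) :
    metricInChart I x₀ y (christoffel I x₀ y u v) w = christoffelFirst I x₀ y u v w := by
  let B : E →ₗ[ℝ] Module.Dual ℝ E := LinearMap.mk₂ ℝ (metricInChart I x₀ y)
    (metricInChart_add_left x₀ y) (metricInChart_smul_left x₀ y)
    (metricInChart_add_right x₀ y) (metricInChart_smul_right x₀ y)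
  have hinj : Function.Injective B := by
    rw [injective_iff_map_eq_zero]
    intro a ha
    exact metricInChart_left_injective hy fun w ↦ LinearMap.congr_fun ha w
  have hsurj : Function.Surjective B :=
    (LinearMap.injective_iff_surjective_of_finrank_eq_finrank
      Subspace.dual_finrank_eq.symm).1 hinj
  have hd := fun a b ↦ differentiableAt_metricInChart (I := I) hy a b
  let L : Module.Dual ℝ E :=
    { toFun := fun w ↦ christoffelFirst I x₀ y u v w
      map_add' := fun w w' ↦ by
        have h (a : E) : (fun z ↦ metricInChart I x₀ z a (w + w')) =
            (fun z ↦ metricInChart I x₀ z a w) + fun z ↦ metricInChart I x₀ z a w' := by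
          ext z
          exact metricInChart_add_right x₀ z a w w'
        simp only [christoffelFirst, h, fderiv_add (hd _ _) (hd _ _), map_add,
          add_apply]
        ring
      map_smul' := fun r w ↦ by
        have h (a : E) : (fun z ↦ metricInChart I x₀ z a (r • w)) =
            r • fun z ↦ metricInChart I x₀ z a w := by
          ext z
          exact metricInChart_smul_right x₀ z r a w
        simp only [christoffelFirst, h, fderiv_const_smul (hd _ _), map_smul,
          smul_apply, smul_eq_mul, RingHom.id_apply]
        ring }
  obtain ⟨a, ha⟩ := hsurj L
  exact Classical.epsilon_spec
    (p := fun a ↦ ∀ w, metricInChart I x₀ y a w = christoffelFirst I x₀ y u v w)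
    ⟨a, fun w ↦ LinearMap.congr_fun ha w⟩ w

end RiemannianGeodesics

/-! Convexity only involves geodesic segments, so it suffices that an isometry carries geodesics to
geodesics; the converse is the same statement for the inverse isometry. Let F be the expression of φ
in charts and DF its differential. The isometry condition reads g(DF u, DF v) = g'(u, v)
(`metricInChart_coordExpr`). Differentiating it and forming the Koszul combination gives D²F(u, v) +
Γ(DF u, DF v) = DF Γ'(u, v) (`christoffel_coordExpr`). For a coordinate curve c, the chain rule
gives (F ∘ c)'' = D²F(c', c') + DF c'', so DF maps the covariant acceleration of a curve to that of
its image (`covariantAcceleration_comp`), and zero goes to zero. -/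

/-! ### Calculus of families of linear maps -/

/-- A family of continuous linear maps on a finite-dimensional space is differentiable if it is so
pointwise. -/
theorem differentiableAt_clm_of_apply {X E G : Type*} [NormedAddCommGroup X] [NormedSpace ℝ X]
    [NormedAddCommGroup E] [NormedSpace ℝ E] [FiniteDimensional ℝ E]
    [NormedAddCommGroup G] [NormedSpace ℝ G] {f : X → E →L[ℝ] G} {x : X}
    (h : ∀ a, DifferentiableAt ℝ (fun z ↦ f z a) x) : DifferentiableAt ℝ f x := by
  let d := Module.finrank ℝ E
  have hd : d = Module.finrank ℝ (Fin d → ℝ) := (Module.finrank_fin_fun ℝ).symm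
  let e₁ := ContinuousLinearEquiv.ofFinrankEq hd
  -- A basis turns a linear map into the finite tuple of its values on basis vectors, and tuples are
  -- differentiable componentwise.
  let e₂ := (e₁.arrowCongr (1 : G ≃L[ℝ] G)).trans (ContinuousLinearEquiv.piRing (Fin d))
  rw [← Function.id_comp f, ← e₂.symm_comp_self]
  exact e₂.symm.differentiable.differentiableAt.comp x (differentiableAt_pi.2 fun i ↦ h _)

/-- The product rule for a family of linear forms applied to a variable vector. -/
theorem fderiv_clm_apply_eq_add {X E : Type*} [NormedAddCommGroup X] [NormedSpace ℝ X]
    [NormedAddCommGroup E] [NormedSpace ℝ E] {L : X → E →L[ℝ] ℝ} {b : X → E} {y : X}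
    (hL : DifferentiableAt ℝ L y) (hb : DifferentiableAt ℝ b y) (u : X) :
    fderiv ℝ (fun z ↦ L z (b z)) y u =
      fderiv ℝ (fun z ↦ L z (b y)) y u + L y (fderiv ℝ b y u) := by
  rw [fderiv_clm_apply hL hb, fderiv_clm_apply hL (differentiableAt_const _)]
  simp [add_comm]

/-! ### The metric along a map, and inverse isometries -/

noncomputable section

variable {E : Type*} [NormedAddCommGroup E] [NormedSpace ℝ E]
  {H : Type*} [TopologicalSpace H] {I : ModelWithCorners ℝ E H}
  {M : Type*} [TopologicalSpace M] [ChartedSpace H M]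
  [RiemannianBundle (fun x : M ↦ TangentSpace I x)]
  {E' : Type*} [NormedAddCommGroup E'] [NormedSpace ℝ E']
  {H' : Type*} [TopologicalSpace H'] {I' : ModelWithCorners ℝ E' H'}
  {M' : Type*} [TopologicalSpace M'] [ChartedSpace H' M']
  [RiemannianBundle (fun x : M' ↦ TangentSpace I' x)]

theorem metricInChart_sub_left (x₀ : M) (y u u' v : E) :
    metricInChart I x₀ y (u - u') v = metricInChart I x₀ y u v - metricInChart I x₀ y u' v := by
  rw [eq_sub_iff_add_eq, ← metricInChart_add_left, sub_add_cancel]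

variable (I) in
/-- The metric in a chart as a continuous linear form in its second argument. -/
def metricInChartL [FiniteDimensional ℝ E] (x₀ : M) (y u : E) : E →L[ℝ] ℝ :=
  LinearMap.toContinuousLinearMap
    { toFun := metricInChart I x₀ y u
      map_add' := metricInChart_add_right x₀ y u
      map_smul' := fun r v ↦ metricInChart_smul_right x₀ y r u v }

/-- The product rule for the metric along a map `F` applied to variable vectors. -/
theorem fderiv_metricInChart_comp [FiniteDimensional ℝ E] [I.Boundaryless] [IsManifold I ∞ M]
    [IsContMDiffRiemannianBundle I ∞ E (fun x : M ↦ TangentSpace I x)] {x₀ : M}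
    {F a b : E' → E} {y : E'} (hy : F y ∈ (extChartAt I x₀).target)
    (hF : DifferentiableAt ℝ F y) (ha : DifferentiableAt ℝ a y) (hb : DifferentiableAt ℝ b y)
    (u : E') :
    fderiv ℝ (fun z ↦ metricInChart I x₀ (F z) (a z) (b z)) y u =
      fderiv ℝ (fun z ↦ metricInChart I x₀ z (a y) (b y)) (F y) (fderiv ℝ F y u)
      + metricInChart I x₀ (F y) (fderiv ℝ a y u) (b y)
      + metricInChart I x₀ (F y) (a y) (fderiv ℝ b y u) := by
  have hFg (v w : E) : DifferentiableAt ℝ (fun z ↦ metricInChart I x₀ (F z) v w) y :=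
    (differentiableAt_metricInChart hy v w).fun_comp' y hF
  have hr (v : E) : DifferentiableAt ℝ (fun z ↦ metricInChartL I x₀ (F z) v) y :=
    differentiableAt_clm_of_apply (hFg v)
  have hl : DifferentiableAt ℝ (fun z ↦ metricInChartL I x₀ (F z) (b z)) y :=
    differentiableAt_clm_of_apply fun v ↦
      ((hr v).clm_apply hb).congr_of_eventuallyEq
        (Filter.Eventually.of_forall fun z ↦ metricInChart_symm x₀ (F z) (b z) v)
  -- The vector arguments are frozen one at a time: `h1` splits off the derivative of `a`, `h2` that
  -- of `b`, and `h3` is the chain rule through `F` for what remains.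
  have h1 := fderiv_clm_apply_eq_add hl ha u
  have h2 := fderiv_clm_apply_eq_add (hr (a y)) hb u
  have h3 := congrArg (fun T ↦ T u)
    (fderiv_fun_comp y (differentiableAt_metricInChart (I := I) hy (a y) (b y)) hF)
  simp only [metricInChartL, LinearMap.coe_toContinuousLinearMap', LinearMap.coe_mk,
    AddHom.coe_mk, metricInChart_symm _ _ (b _) _, ContinuousLinearMap.comp_apply] at h1 h2 h3
  rw [h1, h2, h3]
  ring

/-- The inner product of tangent vectors does not depend on how the base point is written. -/
theorem inner_tangentSpace_congr {x x' : M} (h : x = x') {a b : TangentSpace I x}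
    {a' b' : TangentSpace I x'} (ha : (show E from a) = a') (hb : (show E from b) = b') :
    (inner ℝ a b : ℝ) = inner ℝ a' b' := by
  subst h
  subst ha
  subst hb
  rfl

/-- The inverse of an isometry is an isometry. -/
theorem IsRiemannianIsometry.symm [IsManifold I ∞ M] [IsManifold I' ∞ M']
    {φ : M' ≃ₘ⟮I', I⟯ M} (hφ : IsRiemannianIsometry φ) :
    IsRiemannianIsometry φ.symm := by
  intro p u v
  have hc : (φ ∘ φ.symm : M → M) = id := funext φ.apply_symm_apply
  have hd := mfderiv_comp p (φ.contMDiff.mdifferentiable (by simp) (φ.symm p))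
    (φ.symm.contMDiff.mdifferentiable (by simp) p)
  rw [hc, mfderiv_id] at hd
  rw [← hφ]
  -- The vectors now live over `φ (φ.symm p)`, which is only propositionally equal to `p`.
  exact inner_tangentSpace_congr (φ.apply_symm_apply p) (DFunLike.congr_fun hd u).symm
    (DFunLike.congr_fun hd v).symm

end

/-! ### The diffeomorphism in charts -/

noncomputable section

variable {E : Type*} [NormedAddCommGroup E] [NormedSpace ℝ E]
  {H : Type*} [TopologicalSpace H] {I : ModelWithCorners ℝ E H}
  {M : Type*} [TopologicalSpace M] [ChartedSpace H M]
  {E' : Type*} [NormedAddCommGroup E'] [NormedSpace ℝ E']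
  {H' : Type*} [TopologicalSpace H'] {I' : ModelWithCorners ℝ E' H'}
  {M' : Type*} [TopologicalSpace M'] [ChartedSpace H' M']

/-- The expression of `φ` in the charts centred at `p` and `φ p`. -/
def coordExpr (φ : M' ≃ₘ⟮I', I⟯ M) (p : M') (z : E') : E :=
  extChartAt I (φ p) (φ ((extChartAt I' p).symm z))

/-- The open set of coordinates where `coordExpr φ p` expresses `φ`. -/
def coordDomain (φ : M' ≃ₘ⟮I', I⟯ M) (p : M') : Set E' :=
  (extChartAt I' p).target ∩
    (extChartAt I' p).symm ⁻¹' (φ ⁻¹' (extChartAt I (φ p)).source)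

theorem mem_coordDomain (φ : M' ≃ₘ⟮I', I⟯ M) (p : M') :
    extChartAt I' p p ∈ coordDomain φ p := by
  refine ⟨mem_extChartAt_target p, ?_⟩
  simp

theorem isOpen_coordDomain [I'.Boundaryless] (φ : M' ≃ₘ⟮I', I⟯ M) (p : M') :
    IsOpen (coordDomain φ p) :=
  (continuousOn_extChartAt_symm p).isOpen_inter_preimage (isOpen_extChartAt_target p)
    ((isOpen_extChartAt_source (I := I) (φ p)).preimage φ.continuous)

theorem coordExpr_mem_target {φ : M' ≃ₘ⟮I', I⟯ M} {p : M'} {z : E'} (hz : z ∈ coordDomain φ p) :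
    coordExpr φ p z ∈ (extChartAt I (φ p)).target :=
  (extChartAt I (φ p)).map_source hz.2

theorem extChartAt_symm_coordExpr {φ : M' ≃ₘ⟮I', I⟯ M} {p : M'} {z : E'}
    (hz : z ∈ coordDomain φ p) :
    (extChartAt I (φ p)).symm (coordExpr φ p z) = φ ((extChartAt I' p).symm z) :=
  (extChartAt I (φ p)).left_inv hz.2

variable [I.Boundaryless] [IsManifold I ∞ M] [I'.Boundaryless] [IsManifold I' ∞ M']

theorem contMDiffAt_extChartAt_symm_of_mem {p : M'} {z : E'} (hz : z ∈ (extChartAt I' p).target) :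
    ContMDiffAt 𝓘(ℝ, E') I' ∞ (extChartAt I' p).symm z :=
  (contMDiffOn_extChartAt_symm p).contMDiffAt ((isOpen_extChartAt_target p).mem_nhds hz)

omit [I.Boundaryless] in
theorem contDiffAt_coordExpr {φ : M' ≃ₘ⟮I', I⟯ M} {p : M'} {z : E'} (hz : z ∈ coordDomain φ p) :
    ContDiffAt ℝ ∞ (coordExpr φ p) z := by
  rw [← contMDiffAt_iff_contDiffAt]
  have h1 := contMDiffAt_extChartAt_symm_of_mem (I' := I') hz.1
  have h2 : ContMDiffAt I 𝓘(ℝ, E) ∞ (extChartAt I (φ p)) (φ ((extChartAt I' p).symm z)) :=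
    contMDiffAt_extChartAt' (by simpa using hz.2)
  exact h2.comp z (φ.contMDiff.contMDiffAt.comp z h1)

/-- The differential of `coordExpr φ p`, read in the manifold. -/
theorem mfderiv_extChartAt_symm_coordExpr {φ : M' ≃ₘ⟮I', I⟯ M} {p : M'} {z : E'}
    (hz : z ∈ coordDomain φ p) (u : E') :
    (show E from mfderiv 𝓘(ℝ, E) I (extChartAt I (φ p)).symm (coordExpr φ p z)
      (fderiv ℝ (coordExpr φ p) z u)) =
    mfderiv I' I φ ((extChartAt I' p).symm z)
      (mfderiv 𝓘(ℝ, E') I' (extChartAt I' p).symm z u) := by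
  have hF : MDifferentiableAt 𝓘(ℝ, E') 𝓘(ℝ, E) (coordExpr φ p) z :=
    ((contDiffAt_coordExpr hz).differentiableAt (by simp)).mdifferentiableAt
  have h1 := mfderiv_comp z ((contMDiffAt_extChartAt_symm_of_mem (I' := I)
    (coordExpr_mem_target hz)).mdifferentiableAt (by simp)) hF
  have h2 := mfderiv_comp z (φ.contMDiff.mdifferentiable (by simp) _)
    ((contMDiffAt_extChartAt_symm_of_mem (I' := I') hz.1).mdifferentiableAt (by simp))
  have h3 : (extChartAt I (φ p)).symm ∘ coordExpr φ p =ᶠ[nhds z] φ ∘ (extChartAt I' p).symm :=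
    Filter.eventually_of_mem ((isOpen_coordDomain φ p).mem_nhds hz)
      fun w hw ↦ extChartAt_symm_coordExpr hw
  have h4 := h3.mfderiv_eq (I := 𝓘(ℝ, E')) (I' := I)
  rw [mfderiv_eq_fderiv] at h1
  exact (DFunLike.congr_fun h1 u).symm.trans
    ((DFunLike.congr_fun h4 u).trans (DFunLike.congr_fun h2 u))

/-! ### Metric and Christoffel symbols under an isometry -/

variable [RiemannianBundle (fun x : M ↦ TangentSpace I x)]
  [RiemannianBundle (fun x : M' ↦ TangentSpace I' x)]

theorem IsRiemannianIsometry.metricInChart_coordExpr {φ : M' ≃ₘ⟮I', I⟯ M}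
    (hφ : IsRiemannianIsometry φ) {p : M'} {z : E'} (hz : z ∈ coordDomain φ p) (u v : E') :
    metricInChart I (φ p) (coordExpr φ p z) (fderiv ℝ (coordExpr φ p) z u)
      (fderiv ℝ (coordExpr φ p) z v) = metricInChart I' p z u v :=
  (inner_tangentSpace_congr (extChartAt_symm_coordExpr hz)
    (mfderiv_extChartAt_symm_coordExpr hz u) (mfderiv_extChartAt_symm_coordExpr hz v)).trans
    (hφ _ _ _)

-- The differentials of φ and of both inverse charts are invertible. This lets nondegeneracy on `M`
-- be tested on vectors of the form DF w alone.
omit [RiemannianBundle (fun x : M ↦ TangentSpace I x)]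
  [RiemannianBundle (fun x : M' ↦ TangentSpace I' x)] in
theorem surjective_fderiv_coordExpr {φ : M' ≃ₘ⟮I', I⟯ M} {p : M'} {z : E'}
    (hz : z ∈ coordDomain φ p) : Function.Surjective (fderiv ℝ (coordExpr φ p) z) := by
  intro w
  have hi := isInvertible_mfderivWithin_extChartAt_symm (I := I') hz.1
  have hj := isInvertible_mfderivWithin_extChartAt_symm (I := I) (coordExpr_mem_target hz)
  rw [I'.range_eq_univ, mfderivWithin_univ] at hi
  rw [I.range_eq_univ, mfderivWithin_univ] at hj
  obtain ⟨a, ha⟩ := (φ.mfderivToContinuousLinearEquiv (x := (extChartAt I' p).symm z)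
    (by simp)).surjective (mfderiv 𝓘(ℝ, E) I (extChartAt I (φ p)).symm (coordExpr φ p z) w : E)
  obtain ⟨u, rfl⟩ := hi.surjective a
  exact ⟨u, hj.injective ((mfderiv_extChartAt_symm_coordExpr hz u).trans ha)⟩

variable [FiniteDimensional ℝ E] [FiniteDimensional ℝ E']
  [IsContMDiffRiemannianBundle I ∞ E (fun x : M ↦ TangentSpace I x)]
  [IsContMDiffRiemannianBundle I' ∞ E' (fun x : M' ↦ TangentSpace I' x)]

-- The pullback identity holds on a neighbourhood, so it may be differentiated: one term from moving
-- the base point, and one second derivative of F per vector slot.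
omit [FiniteDimensional ℝ E']
  [IsContMDiffRiemannianBundle I' ∞ E' (fun x : M' ↦ TangentSpace I' x)] in
theorem IsRiemannianIsometry.fderiv_metricInChart {φ : M' ≃ₘ⟮I', I⟯ M}
    (hφ : IsRiemannianIsometry φ) {p : M'} {z : E'} (hz : z ∈ coordDomain φ p) (u v w : E') :
    fderiv ℝ (fun y ↦ metricInChart I' p y v w) z u =
      fderiv ℝ (fun y ↦ metricInChart I (φ p) y (fderiv ℝ (coordExpr φ p) z v)
        (fderiv ℝ (coordExpr φ p) z w)) (coordExpr φ p z) (fderiv ℝ (coordExpr φ p) z u)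
      + metricInChart I (φ p) (coordExpr φ p z)
        (fderiv ℝ (fderiv ℝ (coordExpr φ p)) z u v) (fderiv ℝ (coordExpr φ p) z w)
      + metricInChart I (φ p) (coordExpr φ p z)
        (fderiv ℝ (coordExpr φ p) z v) (fderiv ℝ (fderiv ℝ (coordExpr φ p)) z u w) := by
  have hF := contDiffAt_coordExpr hz
  have hD : DifferentiableAt ℝ (fderiv ℝ (coordExpr φ p)) z :=
    (hF.fderiv_right (m := 1) (by norm_cast)).differentiableAt one_ne_zero
  have happ (v : E') : fderiv ℝ (fun y ↦ fderiv ℝ (coordExpr φ p) y v) z u =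
      fderiv ℝ (fderiv ℝ (coordExpr φ p)) z u v := by
    rw [fderiv_clm_apply hD (differentiableAt_const _)]
    simp
  have he : (fun y ↦ metricInChart I' p y v w) =ᶠ[nhds z] fun y ↦ metricInChart I (φ p)
      (coordExpr φ p y) (fderiv ℝ (coordExpr φ p) y v) (fderiv ℝ (coordExpr φ p) y w) :=
    Filter.eventually_of_mem ((isOpen_coordDomain φ p).mem_nhds hz)
      fun y hy ↦ (hφ.metricInChart_coordExpr hy v w).symm
  rw [he.fderiv_eq, fderiv_metricInChart_comp (coordExpr_mem_target hz)
    (hF.differentiableAt (by simp)) (hD.clm_apply (differentiableAt_const _))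
    (hD.clm_apply (differentiableAt_const _)), happ, happ]

/-- The transformation law of the Christoffel symbols under an isometry. -/
theorem IsRiemannianIsometry.christoffel_coordExpr {φ : M' ≃ₘ⟮I', I⟯ M}
    (hφ : IsRiemannianIsometry φ) {p : M'} {z : E'} (hz : z ∈ coordDomain φ p) (u v : E') :
    fderiv ℝ (fderiv ℝ (coordExpr φ p)) z u v +
      christoffel I (φ p) (coordExpr φ p z) (fderiv ℝ (coordExpr φ p) z u)
        (fderiv ℝ (coordExpr φ p) z v) =
      fderiv ℝ (coordExpr φ p) z (christoffel I' p z u v) := by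
  have ht := coordExpr_mem_target hz
  have hs (a b : E') : fderiv ℝ (fderiv ℝ (coordExpr φ p)) z a b =
      fderiv ℝ (fderiv ℝ (coordExpr φ p)) z b a :=
    ((contDiffAt_coordExpr hz).isSymmSndFDerivAt (by simp; norm_cast)) a b
  rw [← sub_eq_zero]
  refine metricInChart_left_injective ht fun w ↦ ?_
  obtain ⟨w, rfl⟩ := surjective_fderiv_coordExpr hz w
  -- In the Koszul sum, symmetry of D²F and of the metric cancels the terms with D²F(u, w) and
  -- D²F(v, w); g(D²F(u, v), DF w) appears twice and the factor 1/2 leaves it once.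
  rw [metricInChart_sub_left, metricInChart_add_left, metricInChart_christoffel ht,
    hφ.metricInChart_coordExpr hz, metricInChart_christoffel hz.1, christoffelFirst,
    christoffelFirst, hφ.fderiv_metricInChart hz, hφ.fderiv_metricInChart hz,
    hφ.fderiv_metricInChart hz, hs v u, hs w u, hs w v,
    metricInChart_symm (φ p) _ (fderiv ℝ (coordExpr φ p) z v)
      (fderiv ℝ (fderiv ℝ (coordExpr φ p)) z u w)]
  ring

/-! ### Transport of geodesics and convexity -/

/-- The covariant acceleration is natural under isometries. -/
theorem IsRiemannianIsometry.covariantAcceleration_comp {φ : M' ≃ₘ⟮I', I⟯ M}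
    (hφ : IsRiemannianIsometry φ) {γ : ℝ → M'} {t : ℝ} (hγ : ContMDiffAt 𝓘(ℝ, ℝ) I' ∞ γ t) :
    covariantAcceleration I (φ ∘ γ) t =
      fderiv ℝ (coordExpr φ (γ t)) (extChartAt I' (γ t) (γ t))
        (covariantAcceleration I' γ t) := by
  have hz := mem_coordDomain φ (γ t)
  set p := γ t
  let c : ℝ → E' := fun s ↦ extChartAt I' p (γ s)
  let d : ℝ → E := fun s ↦ extChartAt I (φ p) (φ (γ s))
  have hct : c t ∈ coordDomain φ p := hz
  have hcs : ContDiffAt ℝ ∞ c t :=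
    contMDiffAt_iff_contDiffAt.1 ((contMDiffAt_extChartAt (x := p)).comp t hγ)
  have hc : ∀ᶠ s in nhds t, DifferentiableAt ℝ c s :=
    ((hcs.of_le (m := 1) (by norm_cast)).eventually (by simp)).mono
      fun s hs ↦ hs.differentiableAt one_ne_zero
  have hcdom : ∀ᶠ s in nhds t, c s ∈ coordDomain φ p :=
    hcs.continuousAt.eventually ((isOpen_coordDomain φ p).mem_nhds hct)
  have hd : d =ᶠ[nhds t] fun s ↦ coordExpr φ p (c s) := by
    filter_upwards [hγ.continuousAt.eventually (extChartAt_source_mem_nhds (I := I') p)] with s hs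
    simp only [d, c, coordExpr, (extChartAt I' p).left_inv hs]
  -- Equality near `t`, not just at `t`, is needed because this is differentiated once more.
  have hd' : deriv d =ᶠ[nhds t] fun s ↦ fderiv ℝ (coordExpr φ p) (c s) (deriv c s) := by
    filter_upwards [hd.eventuallyEq_nhds, hc, hcdom] with s hs hcs hcd
    rw [hs.deriv_eq]
    exact (((contDiffAt_coordExpr hcd).differentiableAt (by simp)).hasFDerivAt.comp_hasDerivAt s
      hcs.hasDerivAt).deriv
  have hD : DifferentiableAt ℝ (fderiv ℝ (coordExpr φ p)) (c t) :=
    ((contDiffAt_coordExpr hct).fderiv_right (m := 1) (by norm_cast)).differentiableAt one_ne_zero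
  have hc2 : DifferentiableAt ℝ (deriv c) t :=
    ((hcs.fderiv_right (m := 1) (by norm_cast)).differentiableAt one_ne_zero).clm_apply
      (differentiableAt_const (1 : ℝ))
  have hd2 : deriv (deriv d) t = fderiv ℝ (fderiv ℝ (coordExpr φ p)) (c t) (deriv c t) (deriv c t)
      + fderiv ℝ (coordExpr φ p) (c t) (deriv (deriv c) t) := by
    rw [hd'.deriv_eq]
    exact ((hD.hasFDerivAt.comp_hasDerivAt t hc.self_of_nhds.hasDerivAt).clm_apply
      hc2.hasDerivAt).deriv
  change deriv (deriv d) t + christoffel I (φ p) (d t) (deriv d t) (deriv d t) =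
    fderiv ℝ (coordExpr φ p) (c t)
      (deriv (deriv c) t + christoffel I' p (c t) (deriv c t) (deriv c t))
  rw [map_add, ← hφ.christoffel_coordExpr hct, hd2, hd'.eq_of_nhds, hd.eq_of_nhds]
  abel

/-- Openness of `s` gives smoothness at each time, as naturality of the acceleration requires. -/
theorem IsRiemannianIsometry.isGeodesicOn_comp {φ : M' ≃ₘ⟮I', I⟯ M}
    (hφ : IsRiemannianIsometry φ) {γ : ℝ → M'} {s : Set ℝ} (hs : IsOpen s)
    (hγ : IsGeodesicOn I' γ s) : IsGeodesicOn I (φ ∘ γ) s := by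
  refine ⟨φ.contMDiff.comp_contMDiffOn hγ.1, fun t ht ↦ ?_⟩
  rw [hφ.covariantAcceleration_comp (hγ.1.contMDiffAt (hs.mem_nhds ht)), hγ.2 t ht]
  exact map_zero _

theorem IsRiemannianIsometry.comp_mem_geodesicSegments {φ : M' ≃ₘ⟮I', I⟯ M}
    (hφ : IsRiemannianIsometry φ) {p q : M'} {γ : Set.Icc (0 : ℝ) 1 → M'}
    (hγ : γ ∈ geodesicSegments I' p q) : φ ∘ γ ∈ geodesicSegments I (φ p) (φ q) := by
  obtain ⟨h0, h1, c, a, b, ha, hb, hc, hγc⟩ := hγ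
  exact ⟨congrArg φ h0, congrArg φ h1, φ ∘ c, a, b, ha, hb, hφ.isGeodesicOn_comp isOpen_Ioo hc,
    fun t ↦ congrArg φ (hγc t)⟩

theorem GeodesicallyConvex.comp_isometry {φ : M' ≃ₘ⟮I', I⟯ M} (hφ : IsRiemannianIsometry φ)
    {g : M → ℝ} (hg : GeodesicallyConvex I g) : GeodesicallyConvex I' (g ∘ φ) :=
  fun p q _ hγ t ↦ hg (φ p) (φ q) _ (hφ.comp_mem_geodesicSegments hγ) t

end

theorem mainTheorem7
    {E : Type*} [NormedAddCommGroup E] [NormedSpace ℝ E] [FiniteDimensional ℝ E]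
    {H : Type*} [TopologicalSpace H] {I : ModelWithCorners ℝ E H} [I.Boundaryless]
    {M : Type*} [TopologicalSpace M] [ChartedSpace H M] [IsManifold I ∞ M]
    [RiemannianBundle (fun x : M ↦ TangentSpace I x)]
    [IsContMDiffRiemannianBundle I ∞ E (fun x : M ↦ TangentSpace I x)]
    {E' : Type*} [NormedAddCommGroup E'] [NormedSpace ℝ E'] [FiniteDimensional ℝ E']
    {H' : Type*} [TopologicalSpace H'] {I' : ModelWithCorners ℝ E' H'} [I'.Boundaryless]
    {M' : Type*} [TopologicalSpace M'] [ChartedSpace H' M'] [IsManifold I' ∞ M']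
    [RiemannianBundle (fun x : M' ↦ TangentSpace I' x)]
    [IsContMDiffRiemannianBundle I' ∞ E' (fun x : M' ↦ TangentSpace I' x)]
    (φ : M' ≃ₘ⟮I', I⟯ M) (hφ : IsRiemannianIsometry φ) (g : M → ℝ) :
    GeodesicallyConvex I g ↔ GeodesicallyConvex I' (g ∘ φ) := by
  refine ⟨fun h ↦ h.comp_isometry hφ, fun h ↦ ?_⟩
  -- The inverse isometry is applied to g ∘ φ, and (g ∘ φ) ∘ φ⁻¹ = g.
  have h2 := h.comp_isometry hφ.symm
  rwa [Function.comp_assoc, show (φ ∘ φ.symm : M → M) = id from funext φ.apply_symm_apply,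
    Function.comp_id] at h2
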